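/- Let $L,H\in\mathbb{C}^{d\times d}$ be Hermitian matrices, let $t>0$, $\beta\in(0,1)$, $C_\beta=2\pi e^{-2^\beta}$, and $$g(k)=\frac{1}{C_\beta(1-ik)e^{(1+ik)^\beta}},\qquad U(t,k)=e^{-it(kL+H)}\qquad(k\in\mathbb{R}),$$ with the principal branch of the power. Let $K,h>0$ be such that $K/h$ is an integer. For $Q\ge 1$ let $x_1,\dots,x_Q$ be the roots of the Legendre polynomial $P_Q$, let $\omega_q=\frac{2}{(1-x_q^2)P_Q'(x_q)^2}$ be the corresponding Gauss weights on $[-1,1]$, and for $m\in\mathbb{Z}$ put $$k_{q,m}=\frac h2x_q+\frac{(2m+1)h}{2},\qquad c_{q,m}=\frac h2\,\omega_q\,g(k_{q,m}),$$ $$E(Q)=\Big\|\int_{-K}^{K}g(k)U(t,k)\,dk-\sum_{m=-K/h}^{K/h-1}\sum_{q=1}^{Q}c_{q,m}U(t,k_{q,m})\Big\|,$$ where $\|\cdot\|$ is the spectral norm. Then for every $\epsilon_{\mathrm{disc}}>0$ there is an integer $Q>0$ with $E(Q)\le\epsilon_{\mathrm{disc}}$. Moreover, suppose that $h=1/(et\|L\|)$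 and $h\le 1$, and that $$-\frac1e\le z:=\frac{-3C_\beta}{2\pi e^{1/3}\log_2(e)}\,\frac{\epsilon_{\mathrm{disc}}}{K},$$ so that $z\in[-1/e,0)$ and $W_{-1}(z)$, the unique real $w\le-1$ with $we^w=z$, is defined. Then the choice $$Q=\Big\lceil-\frac{\log_2(e)}{4}\,W_{-1}(z)\Big\rceil$$ is a positive integer and satisfies $E(Q)\le\epsilon_{\mathrm{disc}}$. -/

import Mathlib

open scoped Matrix.Norms.L2Operator

noncomputable section

/-- The normalization constant `C_β = 2π exp(-2^β)`. -/
def normConst (β : ℝ) : ℝ :=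
  2 * Real.pi * Real.exp (-(2 : ℝ) ^ β)

/-- The kernel `g(k) = 1 / (C_β (1 - i k) exp((1 + i k)^β))`, with the principal branch of the
power. -/
def kernel (β k : ℝ) : ℂ :=
  1 / ((normConst β : ℂ) * (1 - Complex.I * (k : ℂ)) *
    Complex.exp ((1 + Complex.I * (k : ℂ)) ^ (β : ℂ)))

/-- The propagator `U(t, k) = exp(-i t (k L + H))`. -/
def propagator {d : ℕ} (L H : Matrix (Fin d) (Fin d) ℂ) (t k : ℝ) : Matrix (Fin d) (Fin d) ℂ :=
  NormedSpace.exp ((-(Complex.I * (t : ℂ))) • ((k : ℂ) • L + H))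

/-- The Legendre polynomial `P_n`, by Rodrigues' formula
`P_n = 1 / (2^n n!) (d/dX)^n (X^2 - 1)^n`. -/
def legendrePoly (n : ℕ) : Polynomial ℝ :=
  Polynomial.C (1 / ((2 : ℝ) ^ n * (n.factorial : ℝ))) *
    Polynomial.derivative^[n] ((Polynomial.X ^ 2 - 1) ^ n)

/-- The nodes of the `n`-point Gauss quadrature rule on `[-1, 1]`: the real roots of `P_n`. -/
def gaussNodes (n : ℕ) : Finset ℝ :=
  (legendrePoly n).roots.toFinset

/-- The weight `2 / ((1 - x^2) P_n'(x)^2)` that belongs to the node `x` of the `n`-point Gauss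
quadrature rule on `[-1, 1]`. -/
def gaussWeight (n : ℕ) (x : ℝ) : ℝ :=
  2 / ((1 - x ^ 2) * ((legendrePoly n).derivative.eval x) ^ 2)

/-- The node of the `m`-th subinterval `[m h, (m + 1) h]` that corresponds to the node `x` of
`[-1, 1]`. -/
def subNode (h : ℝ) (m : ℤ) (x : ℝ) : ℝ :=
  h / 2 * x + (2 * (m : ℝ) + 1) * h / 2

/-- The composite Gauss quadrature sum, with `Q` nodes on each of the subintervals
`[m h, (m + 1) h]`, `-N ≤ m ≤ N - 1`, for the integrand `g(k) U(t, k)`; the coefficient of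
`U(t, k)` at the node `k` is `(h / 2) w g(k)`, where `w` is the Gauss weight. -/
def lchsQuadrature {d : ℕ} (L H : Matrix (Fin d) (Fin d) ℂ) (β t h : ℝ) (N Q : ℕ) :
    Matrix (Fin d) (Fin d) ℂ :=
  ∑ m ∈ Finset.Ico (-(N : ℤ)) (N : ℤ), ∑ x ∈ gaussNodes Q,
    (((h / 2 * gaussWeight Q x : ℝ) : ℂ) * kernel β (subNode h m x)) •
      propagator L H t (subNode h m x)

/-- The branch `W_{-1}` of the Lambert function: for `x ∈ [-1/e, 0)`, the unique `w ≤ -1` with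
`w exp(w) = x`. -/
def lambertWNegOne (x : ℝ) : ℝ :=
  Function.invFunOn (fun w : ℝ => w * Real.exp w) (Set.Iic (-1)) x

/-- The argument `-(3 C_β / (2π e^{1/3} log₂ e)) (ε / K)` at which `W_{-1}` is evaluated. -/
def lambertArg (β K ε : ℝ) : ℝ :=
  -3 * normConst β / (2 * Real.pi * Real.exp (1 / 3) * Real.logb 2 (Real.exp 1)) * (ε / K)

/-- The number of nodes `⌈-(log₂ e / 4) W_{-1}(…)⌉`. -/
def numNodes (β K ε : ℝ) : ℕ :=
  ⌈-(Real.logb 2 (Real.exp 1) / 4) * lambertWNegOne (lambertArg β K ε)⌉₊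

end

/-! A functional of norm at most one that attains the norm of the error reduces the matrix estimate
to a scalar one, and an affine change of variable moves each subinterval to `[-1, 1]`. There the
`Q`-point Gauss rule integrates the Hermite interpolant at its nodes exactly, so its error is at
most `sup |F^(2Q)| / (2Q)!` times the integral of the squared monic nodal polynomial
(`abs_integral_sub_gauss_le`). Rodrigues' formula evaluates that integral, and a central binomial
bound makes it at most `2^(2Q) * 8Q / 16^Q / (2Q+1)`.

The derivative is bounded by Cauchy's estimate (`norm_iteratedDeriv_testedIntegrand_le`). The
integrand is holomorphic in `|Im z| < 1`; there the propagator grows at most like `exp (t ‖L‖ |Im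
z|)`, which is at most `e^(1/e)` when `|Im z| ≤ h`. With `n = 2Q` and radius `h n / (n+1)`, the
kernel is at most `(n+1) / (e C_β)`. The factors `e`, `2Q+1` and `2^(2Q)` all cancel, and summation
over the subintervals gives the bound `K e^(1/e) / C_β * 8Q / 16^Q` (`norm_error_le`). With `y = 4 Q
log 2` this is a multiple of `y e^(-y)`, which `W_{-1}` inverts (`numNodes_spec`).

The existence of some `Q` for arbitrary `h` needs only convergence of Gauss quadrature for
continuous functions, applied to each matrix entry. -/

/-! ### Rolle's theorem and Hermite interpolation. -/

theorem exists_finset_zeros_deriv {f f' : ℝ → ℝ} (hf : ∀ x, HasDerivAt f (f' x) x)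
    {s : Finset ℝ} {a b : ℝ} (hs : ∀ x ∈ s, x ∈ Set.Icc a b) (h0 : ∀ x ∈ s, f x = 0) :
    ∃ t : Finset ℝ, (∀ x ∈ t, x ∈ Set.Ioo a b) ∧ Disjoint s t ∧ (∀ x ∈ t, f' x = 0) ∧
      s.card ≤ t.card + 1 := by
  have hc : Continuous f := continuous_iff_continuousAt.2 fun x => (hf x).continuousAt
  have hR : ∀ x y, ∃ z, x ∈ s → y ∈ s → x < y → z ∈ Set.Ioo x y ∧ f' z = 0 := by
    intro x y
    by_cases h : x ∈ s ∧ y ∈ s ∧ x < y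
    · obtain ⟨z, hz, hz'⟩ := exists_hasDerivAt_eq_zero h.2.2 hc.continuousOn
        ((h0 x h.1).trans (h0 y h.2.1).symm) (fun x _ => hf x)
      exact ⟨z, fun _ _ _ => ⟨hz, hz'⟩⟩
    · exact ⟨0, fun h1 h2 h3 => absurd ⟨h1, h2, h3⟩ h⟩
  choose Z hZ using hR
  set t := ((s ×ˢ s).filter fun p => p.1 < p.2).image fun p => Z p.1 p.2 with ht
  have key : ∀ z ∈ t, z ∈ Set.Ioo a b ∧ f' z = 0 := by
    intro z hz
    simp only [ht, Finset.mem_image, Finset.mem_filter, Finset.mem_product] at hz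
    obtain ⟨⟨x, y⟩, ⟨⟨hx, hy⟩, hxy⟩, rfl⟩ := hz
    obtain ⟨h1, h2⟩ := hZ x y hx hy hxy
    exact ⟨⟨(hs x hx).1.trans_lt h1.1, h1.2.trans_le (hs y hy).2⟩, h2⟩
  refine ⟨t \ s, fun x hx => (key x (Finset.mem_sdiff.1 hx).1).1, Finset.disjoint_sdiff,
    fun x hx => (key x (Finset.mem_sdiff.1 hx).1).2, ?_⟩
  -- The Rolle zero between two neighbours in `s` lies outside `s`, so removing `s` from `t` keeps
  -- enough zeros.
  refine Finset.card_le_sdiff_of_interleaved fun x hx y hy hxy _ => ?_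
  obtain ⟨h1, h2⟩ := hZ x y hx hy hxy
  refine ⟨Z x y, ?_, h1.1, h1.2⟩
  simp only [ht, Finset.mem_image, Finset.mem_filter, Finset.mem_product]
  exact ⟨(x, y), ⟨⟨hx, hy⟩, hxy⟩, rfl⟩

theorem exists_zero_iterated_deriv {F : ℕ → ℝ → ℝ} (hF : ∀ k x, HasDerivAt (F k) (F (k + 1) x) x)
    {a b : ℝ} (m : ℕ) : ∀ (j : ℕ) (s : Finset ℝ), (∀ x ∈ s, x ∈ Set.Icc a b) →
      (∀ x ∈ s, F j x = 0) → m < s.card → ∃ ξ ∈ Set.Icc a b, F (j + m) ξ = 0 := by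
  induction m with
  | zero =>
    intro j s hs h0 hm
    obtain ⟨x, hx⟩ := Finset.card_pos.1 hm
    exact ⟨x, hs x hx, h0 x hx⟩
  | succ m ih =>
    intro j s hs h0 hm
    obtain ⟨t, ht, -, ht0, hcard⟩ := exists_finset_zeros_deriv (hF j) hs h0
    obtain ⟨ξ, hξ, h⟩ := ih (j + 1) t (fun x hx => Set.Ioo_subset_Icc_self (ht x hx)) ht0 (by omega)
    exact ⟨ξ, hξ, by rwa [show j + (m + 1) = j + 1 + m by ring]⟩

theorem iterate_derivative_natDegree_of_monic {p : Polynomial ℝ} (hp : p.Monic) {n : ℕ}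
    (hn : p.natDegree = n) :
    Polynomial.derivative^[n] p = Polynomial.C (n.factorial : ℝ) := by
  ext k
  rw [Polynomial.coeff_iterate_derivative, Polynomial.coeff_C]
  split_ifs with h
  · subst h
    rw [zero_add, Nat.descFactorial_self, ← hn, hp.coeff_natDegree]
    simp
  · rw [Polynomial.coeff_eq_zero_of_natDegree_lt (by omega), smul_zero]

theorem hasDerivAt_iterate_derivative (p : Polynomial ℝ) (k : ℕ) (x : ℝ) :
    HasDerivAt (fun y => (Polynomial.derivative^[k] p).eval y)
      ((Polynomial.derivative^[k + 1] p).eval x) x := by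
  rw [Function.iterate_succ_apply']
  exact (Polynomial.derivative^[k] p).hasDerivAt x

/-- The error of Hermite interpolation. -/
theorem abs_sub_hermite_le {F : ℕ → ℝ → ℝ} (hF : ∀ k x, HasDerivAt (F k) (F (k + 1) x) x)
    {a b M : ℝ} {s : Finset ℝ} {n : ℕ} (hn : s.card = n) (hn0 : 0 < n)
    (hs : ∀ x ∈ s, x ∈ Set.Icc a b)
    (hM : ∀ x ∈ Set.Icc a b, |F (2 * n) x| ≤ M) {H : Polynomial ℝ} (hH : H.natDegree < 2 * n)
    (h0 : ∀ x ∈ s, H.eval x = F 0 x) (h1 : ∀ x ∈ s, H.derivative.eval x = F 1 x)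
    {x : ℝ} (hx : x ∈ Set.Icc a b) :
    |F 0 x - H.eval x| ≤ M / (2 * n).factorial * ((Lagrange.nodal s id).eval x) ^ 2 := by
  by_cases hxs : x ∈ s
  · rw [h0 x hxs, sub_self, abs_zero]
    have : (Lagrange.nodal s id).eval (id x) = 0 := Lagrange.eval_nodal_at_node hxs
    rw [id] at this
    rw [this]; simp
  set w := Lagrange.nodal s (id : ℝ → ℝ) with hw
  have hwx : w.eval x ≠ 0 := by
    rw [hw, Lagrange.eval_nodal, Finset.prod_ne_zero_iff]
    rintro y hy h
    rw [sub_eq_zero] at h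
    exact hxs (by rw [h]; exact hy)
  have hws : ∀ y ∈ s, w.eval y = 0 := fun y hy => Lagrange.eval_nodal_at_node (v := id) hy
  -- With this `c`, the difference `F 0 - p` vanishes at `x` as well, while its double zeros on `s`
  -- persist.
  set c := (F 0 x - H.eval x) / (w.eval x) ^ 2 with hc
  set p := H + Polynomial.C c * w ^ 2 with hp
  have hG : ∀ k y, HasDerivAt (fun y => F k y - (Polynomial.derivative^[k] p).eval y)
      (F (k + 1) y - (Polynomial.derivative^[k + 1] p).eval y) y :=
    fun k y => (hF k y).sub (hasDerivAt_iterate_derivative p k y)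
  obtain ⟨t, ht, hst, ht0, htc⟩ := exists_finset_zeros_deriv (hG 0) (s := insert x s) (a := a)
    (b := b) (by
      intro y hy
      rcases Finset.mem_insert.1 hy with rfl | hy
      exacts [hx, hs y hy]) (by
      intro y hy
      rcases Finset.mem_insert.1 hy with rfl | hy
      · simp only [Function.iterate_zero, id, hp, Polynomial.eval_add, Polynomial.eval_mul,
          Polynomial.eval_C, Polynomial.eval_pow, hc]
        rw [div_mul_cancel₀ _ (pow_ne_zero 2 hwx)]; ring
      · simp [hp, hws y hy, h0 y hy])
  rw [Finset.card_insert_of_notMem hxs, hn] at htc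
  have hst' : Disjoint s t := hst.mono_left (Finset.subset_insert _ _)
  -- The first derivative has `n` zeros in `s` and at least `n` Rolle zeros off `s`; these `2n`
  -- zeros allow `2n - 1` further differentiations.
  obtain ⟨ξ, hξ, hξ0⟩ := exists_zero_iterated_deriv hG (a := a) (b := b) (2 * n - 1) 1 (s ∪ t) (by
      intro y hy
      rcases Finset.mem_union.1 hy with hy | hy
      exacts [hs y hy, Set.Ioo_subset_Icc_self (ht y hy)]) (by
      intro y hy
      rcases Finset.mem_union.1 hy with hy | hy
      · simp [hp, hws y hy, h1 y hy, Polynomial.derivative_pow]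
      · exact ht0 y hy) (by
      rw [Finset.card_union_of_disjoint hst']
      omega)
  rw [show 1 + (2 * n - 1) = 2 * n by omega] at hξ0
  have hwm : (w ^ 2).Monic := (Lagrange.nodal_monic (s := s) (v := id)).pow 2
  have hwd : (w ^ 2).natDegree = 2 * n := by
    rw [Polynomial.natDegree_pow, hw, Lagrange.natDegree_nodal, hn]
  have hpd : Polynomial.derivative^[2 * n] p = Polynomial.C (c * (2 * n).factorial) := by
    rw [hp, iterate_map_add, Polynomial.iterate_derivative_eq_zero hH,
      Polynomial.iterate_derivative_C_mul, iterate_derivative_natDegree_of_monic hwm hwd, zero_add,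
      ← Polynomial.C_mul]
  rw [hpd, Polynomial.eval_C, sub_eq_zero] at hξ0
  have hfac : (0 : ℝ) < (2 * n).factorial := by positivity
  have hcM : |c| ≤ M / (2 * n).factorial := by
    rw [le_div_iff₀ hfac, ← abs_of_pos hfac, ← abs_mul, ← hξ0]
    exact hM ξ hξ
  have : F 0 x - H.eval x = c * (w.eval x) ^ 2 := by
    rw [hc, div_mul_cancel₀ _ (pow_ne_zero 2 hwx)]
  rw [this, abs_mul, abs_of_nonneg (sq_nonneg (w.eval x))]
  exact mul_le_mul_of_nonneg_right hcM (sq_nonneg _)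

/-- Take `p + w * q` with `w` nodal: `p` fixes the values, and `q` corrects the slopes, since `w`
vanishes and `w'` does not vanish at the nodes. -/
theorem exists_hermite_interpolant (s : Finset ℝ) (hs : s.Nonempty) (f f' : ℝ → ℝ) :
    ∃ H : Polynomial ℝ, H.natDegree < 2 * s.card ∧ (∀ x ∈ s, H.eval x = f x) ∧
      ∀ x ∈ s, H.derivative.eval x = f' x := by
  have hinj : Set.InjOn (id : ℝ → ℝ) s := Set.injOn_id _
  have hcard := Finset.card_pos.2 hs
  have hdeg : ∀ r : ℝ → ℝ, (Lagrange.interpolate s id r).natDegree < s.card := fun r => by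
    by_cases h : Lagrange.interpolate s id r = 0
    · simp [h, hcard]
    · exact (Polynomial.natDegree_lt_iff_degree_lt h).2 (Lagrange.degree_interpolate_lt r hinj)
  have hev : ∀ r : ℝ → ℝ, ∀ x ∈ s, (Lagrange.interpolate s id r).eval x = r x := fun r x hx =>
    Lagrange.eval_interpolate_at_node r hinj hx
  set w := Lagrange.nodal s (id : ℝ → ℝ) with hw
  have hws : ∀ y ∈ s, w.eval y = 0 := fun y hy => Lagrange.eval_nodal_at_node (v := id) hy
  have hwd : ∀ y ∈ s, w.derivative.eval y ≠ 0 := fun y hy => by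
    have := Lagrange.eval_nodal_derivative_eval_node_eq (v := (id : ℝ → ℝ)) hy
    rw [id] at this
    rw [hw, this, Lagrange.eval_nodal, Finset.prod_ne_zero_iff]
    intro z hz
    rw [sub_ne_zero]
    exact (Finset.ne_of_mem_erase hz).symm
  set p := Lagrange.interpolate s id f
  set q := Lagrange.interpolate s id fun x => (f' x - p.derivative.eval x) / w.derivative.eval x
    with hq
  refine ⟨p + w * q, ?_, fun x hx => ?_, fun x hx => ?_⟩
  · refine (Polynomial.natDegree_add_le _ _).trans_lt (max_lt ?_ ?_)
    · have : p.natDegree < s.card := hdeg f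
      omega
    · refine Polynomial.natDegree_mul_le.trans_lt ?_
      rw [hw, Lagrange.natDegree_nodal]
      have := hdeg fun x => (f' x - p.derivative.eval x) / w.derivative.eval x
      rw [← hq] at this
      omega
  · rw [Polynomial.eval_add, Polynomial.eval_mul, hws x hx, zero_mul, add_zero]
    exact hev f x hx
  · simp only [Polynomial.derivative_add, Polynomial.derivative_mul, Polynomial.eval_add,
      Polynomial.eval_mul, hws x hx, zero_mul, add_zero, hq, hev _ x hx]
    rw [mul_div_cancel₀ _ (hwd x hx)]
    ring

/-! ### Integration of polynomials by parts on `[-1, 1]`. -/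

/-- The integral of a polynomial over `[-1, 1]`. -/
noncomputable def unitIntegral (p : Polynomial ℝ) : ℝ := ∫ x in (-1 : ℝ)..1, p.eval x

theorem unitIntegral_add (p q : Polynomial ℝ) :
    unitIntegral (p + q) = unitIntegral p + unitIntegral q := by
  simp only [unitIntegral, Polynomial.eval_add]
  exact intervalIntegral.integral_add (p.continuous.intervalIntegrable _ _)
    (q.continuous.intervalIntegrable _ _)

theorem unitIntegral_C_mul (c : ℝ) (p : Polynomial ℝ) :
    unitIntegral (Polynomial.C c * p) = c * unitIntegral p := by
  simp [unitIntegral]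

theorem unitIntegral_sum {ι : Type*} (s : Finset ι) (p : ι → Polynomial ℝ) :
    unitIntegral (∑ i ∈ s, p i) = ∑ i ∈ s, unitIntegral (p i) := by
  classical
  induction s using Finset.induction_on with
  | empty => simp [unitIntegral]
  | insert i s hi ih => rw [Finset.sum_insert hi, Finset.sum_insert hi, unitIntegral_add, ih]

theorem unitIntegral_derivative (p : Polynomial ℝ) :
    unitIntegral p.derivative = p.eval 1 - p.eval (-1) :=
  intervalIntegral.integral_eq_sub_of_hasDerivAt (fun x _ => p.hasDerivAt x)
    (p.derivative.continuous.intervalIntegrable _ _)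

theorem unitIntegral_derivative_mul (p q : Polynomial ℝ) (h1 : p.eval 1 = 0)
    (h2 : p.eval (-1) = 0) :
    unitIntegral (p.derivative * q) = -unitIntegral (p * q.derivative) := by
  have := unitIntegral_derivative (p * q)
  rw [Polynomial.derivative_mul, unitIntegral_add] at this
  simp only [Polynomial.eval_mul, h1, h2, zero_mul, sub_zero] at this
  linarith

theorem eval_one_iterate_derivative {n k : ℕ} (hk : k < n) :
    (Polynomial.derivative^[k] ((Polynomial.X ^ 2 - 1 : Polynomial ℝ) ^ n)).eval 1 = 0 := by
  obtain ⟨q, hq⟩ := Polynomial.pow_sub_dvd_iterate_derivative_pow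
    (Polynomial.X ^ 2 - 1 : Polynomial ℝ) n k
  rw [hq]
  simp [Nat.sub_ne_zero_of_lt hk]

theorem eval_neg_one_iterate_derivative {n k : ℕ} (hk : k < n) :
    (Polynomial.derivative^[k] ((Polynomial.X ^ 2 - 1 : Polynomial ℝ) ^ n)).eval (-1) = 0 := by
  obtain ⟨q, hq⟩ := Polynomial.pow_sub_dvd_iterate_derivative_pow
    (Polynomial.X ^ 2 - 1 : Polynomial ℝ) n k
  rw [hq]
  simp [Nat.sub_ne_zero_of_lt hk]

/-- Integration by parts `k` times; the boundary terms vanish because derivatives of order below `n`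
keep a factor `X^2 - 1`. -/
theorem unitIntegral_iterate_derivative_mul {n : ℕ} (k : ℕ) (hk : k ≤ n) (q : Polynomial ℝ) :
    unitIntegral (Polynomial.derivative^[k] ((Polynomial.X ^ 2 - 1) ^ n) * q) =
      (-1) ^ k * unitIntegral ((Polynomial.X ^ 2 - 1) ^ n * Polynomial.derivative^[k] q) := by
  induction k generalizing q with
  | zero => simp
  | succ k ih =>
    rw [Function.iterate_succ_apply', unitIntegral_derivative_mul _ _
      (eval_one_iterate_derivative hk) (eval_neg_one_iterate_derivative hk), ih (by omega),
      ← Function.iterate_succ_apply]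
    ring

/-- Integrating the derivative of `X (X^2 - 1)^(n+1)`, which vanishes at both endpoints, gives the
recursion `(2n+3) I_{n+1} = -2(n+1) I_n`. -/
theorem unitIntegral_X_sq_sub_one_pow (n : ℕ) :
    (-1) ^ n * unitIntegral ((Polynomial.X ^ 2 - 1) ^ n) * (2 * n + 1).factorial =
      2 ^ (2 * n + 1) * (n.factorial : ℝ) ^ 2 := by
  induction n with
  | zero => simp [unitIntegral]; norm_num
  | succ n ih =>
    have h := unitIntegral_derivative (Polynomial.X * (Polynomial.X ^ 2 - 1) ^ (n + 1))
    have h2 : Polynomial.derivative (Polynomial.X * (Polynomial.X ^ 2 - 1 : Polynomial ℝ) ^ (n + 1))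
        = Polynomial.C (2 * (n + 1) + 1 : ℝ) * (Polynomial.X ^ 2 - 1) ^ (n + 1) +
          Polynomial.C (2 * (n + 1) : ℝ) * (Polynomial.X ^ 2 - 1) ^ n := by
      simp only [Polynomial.derivative_mul, Polynomial.derivative_X, Polynomial.derivative_pow,
        Polynomial.derivative_sub, Polynomial.derivative_one, map_add, map_mul, map_one,
        Polynomial.C_ofNat, Polynomial.C_eq_natCast]
      simp
      ring
    rw [h2, unitIntegral_add, unitIntegral_C_mul, unitIntegral_C_mul] at h
    simp only [Polynomial.eval_mul, Polynomial.eval_pow, Polynomial.eval_sub, Polynomial.eval_X,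
      Polynomial.eval_one] at h
    norm_num at h
    rw [show 2 * (n + 1) + 1 = (2 * n + 1 + 1) + 1 by ring, Nat.factorial_succ (2 * n + 1 + 1),
      Nat.factorial_succ (2 * n + 1), Nat.factorial_succ n]
    push_cast
    have e : unitIntegral ((Polynomial.X ^ 2 - 1) ^ (n + 1)) * (2 * (n + 1) + 1) =
      -(2 * (n + 1) * unitIntegral ((Polynomial.X ^ 2 - 1) ^ n)) := by linarith
    calc _ = (-1) ^ (n + 1) * (unitIntegral ((Polynomial.X ^ 2 - 1) ^ (n + 1)) *
          (2 * (n + 1) + 1)) * ((2 * n + 1 + 1) * (2 * n + 1).factorial) := by ring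
      _ = 4 * (n + 1) ^ 2 * ((-1) ^ n * unitIntegral ((Polynomial.X ^ 2 - 1) ^ n) *
          (2 * n + 1).factorial) := by rw [e]; ring
      _ = _ := by rw [ih]; ring

/-! ### Rodrigues' formula: leading coefficient, endpoint values, zeros. -/

/-- The polynomial `(d/dX)^n (X^2 - 1)^n` of Rodrigues' formula. -/
noncomputable def rodrigues (n : ℕ) : Polynomial ℝ :=
  Polynomial.derivative^[n] ((Polynomial.X ^ 2 - 1) ^ n)

theorem X_sq_sub_one_pow_monic (n : ℕ) : ((Polynomial.X ^ 2 - 1 : Polynomial ℝ) ^ n).Monic := by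
  rw [← Polynomial.C_1]
  exact (Polynomial.monic_X_pow_sub_C 1 two_ne_zero).pow n

theorem X_sq_sub_one_pow_natDegree (n : ℕ) :
    ((Polynomial.X ^ 2 - 1 : Polynomial ℝ) ^ n).natDegree = 2 * n := by
  rw [Polynomial.natDegree_pow, ← Polynomial.C_1, Polynomial.natDegree_X_pow_sub_C, mul_comm]

theorem rodrigues_coeff (n : ℕ) :
    (rodrigues n).coeff n * n.factorial = (2 * n).factorial := by
  rw [rodrigues, Polynomial.coeff_iterate_derivative, ← two_mul]
  have : ((Polynomial.X ^ 2 - 1 : Polynomial ℝ) ^ n).coeff (2 * n) = 1 := by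
    have := (X_sq_sub_one_pow_monic n).coeff_natDegree
    rwa [X_sq_sub_one_pow_natDegree] at this
  rw [this, nsmul_eq_mul, mul_one]
  have h := Nat.factorial_mul_descFactorial (show n ≤ 2 * n by omega)
  rw [show 2 * n - n = n by omega] at h
  rw [← h]; push_cast; ring

theorem rodrigues_coeff_pos (n : ℕ) : 0 < (rodrigues n).coeff n := by
  have h := rodrigues_coeff n
  have h1 : (0 : ℝ) < n.factorial := by positivity
  have h2 : (0 : ℝ) < (2 * n).factorial := by positivity
  rw [← h] at h2
  exact (pos_iff_pos_of_mul_pos h2).2 h1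

theorem rodrigues_ne_zero (n : ℕ) : rodrigues n ≠ 0 := by
  intro h
  have := rodrigues_coeff_pos n
  simp [h] at this

theorem rodrigues_natDegree_le (n : ℕ) : (rodrigues n).natDegree ≤ n := by
  refine (Polynomial.natDegree_iterate_derivative _ _).trans ?_
  rw [X_sq_sub_one_pow_natDegree]
  omega

/-- In Leibniz' formula only the term with all `n` derivatives on `(X - a)^n` survives at `a`. -/
theorem eval_iterate_derivative_mul_pow (n : ℕ) (a b : ℝ) :
    (Polynomial.derivative^[n] ((Polynomial.X - Polynomial.C a) ^ n *
      (Polynomial.X - Polynomial.C b) ^ n)).eval a = n.factorial * (a - b) ^ n := by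
  rw [Polynomial.iterate_derivative_mul, Polynomial.eval_finsetSum,
    Finset.sum_eq_single_of_mem 0 (by simp)]
  · rw [Nat.sub_zero, Polynomial.iterate_derivative_X_sub_pow_self]
    simp
  · intro k hk hk0
    have : k < n + 1 := by simpa using hk
    rw [Polynomial.iterate_derivative_X_sub_pow]
    simp [show n - (n - k) ≠ 0 by omega]

theorem rodrigues_eval_one_sq (n : ℕ) :
    (rodrigues n).eval 1 ^ 2 = ((2 : ℝ) ^ n * n.factorial) ^ 2 := by
  have h := eval_iterate_derivative_mul_pow n 1 (-1)
  rw [← mul_pow, show (Polynomial.X - Polynomial.C 1 : Polynomial ℝ) *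
    (Polynomial.X - Polynomial.C (-1)) = Polynomial.X ^ 2 - 1 by
      rw [Polynomial.C_neg, Polynomial.C_1]; ring] at h
  rw [rodrigues, h]
  norm_num
  ring

theorem rodrigues_eval_neg_one_sq (n : ℕ) :
    (rodrigues n).eval (-1) ^ 2 = ((2 : ℝ) ^ n * n.factorial) ^ 2 := by
  have h := eval_iterate_derivative_mul_pow n (-1) 1
  rw [← mul_pow, show (Polynomial.X - Polynomial.C (-1) : Polynomial ℝ) *
    (Polynomial.X - Polynomial.C 1) = Polynomial.X ^ 2 - 1 by
      rw [Polynomial.C_neg, Polynomial.C_1]; ring] at h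
  rw [rodrigues, h, mul_pow, ← pow_mul, mul_comm n 2, pow_mul, mul_pow, ← pow_mul 2 n 2,
    mul_comm n 2, pow_mul 2 2 n]
  norm_num
  ring

/-- For order `k < n` the endpoints are zeros too. Adding them gives at least `k + 2` zeros, so
Rolle leaves `k + 1` inside. -/
theorem exists_zeros_iterate_derivative {n : ℕ} (k : ℕ) (hk : k ≤ n) :
    ∃ t : Finset ℝ, (∀ x ∈ t, x ∈ Set.Ioo (-1 : ℝ) 1) ∧ k ≤ t.card ∧ ∀ x ∈ t,
      (Polynomial.derivative^[k] ((Polynomial.X ^ 2 - 1 : Polynomial ℝ) ^ n)).eval x = 0 := by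
  induction k with
  | zero => exact ⟨∅, by simp⟩
  | succ k ih =>
    obtain ⟨t, ht, hcard, ht0⟩ := ih (by omega)
    obtain ⟨t', ht', -, ht0', hcard'⟩ := exists_finset_zeros_deriv
      (hasDerivAt_iterate_derivative ((Polynomial.X ^ 2 - 1 : Polynomial ℝ) ^ n) k)
      (s := insert (-1) (insert 1 t)) (a := -1) (b := 1) (by
        intro x hx
        simp only [Finset.mem_insert] at hx
        rcases hx with rfl | rfl | hx
        · norm_num
        · norm_num
        · exact Set.Ioo_subset_Icc_self (ht x hx)) (by
        intro x hx
        simp only [Finset.mem_insert] at hx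
        rcases hx with rfl | rfl | hx
        · exact eval_neg_one_iterate_derivative hk
        · exact eval_one_iterate_derivative hk
        · exact ht0 x hx)
    refine ⟨t', ht', ?_, ht0'⟩
    rw [Finset.card_insert_of_notMem, Finset.card_insert_of_notMem] at hcard'
    · omega
    · exact fun h => lt_irrefl _ (ht _ h).2
    · simp only [Finset.mem_insert, not_or]
      exact ⟨by norm_num, fun h => lt_irrefl _ (ht _ h).1⟩

/-! ### Nodes, exactness and weights of the Gauss rule. -/

theorem legendrePoly_eq (n : ℕ) :
    legendrePoly n = Polynomial.C (1 / ((2 : ℝ) ^ n * n.factorial)) * rodrigues n := rfl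

theorem legendrePoly_ne_zero (n : ℕ) : legendrePoly n ≠ 0 := by
  rw [legendrePoly_eq]
  refine mul_ne_zero ?_ (rodrigues_ne_zero n)
  rw [Ne, Polynomial.C_eq_zero]
  positivity

theorem gaussNodes_spec (n : ℕ) :
    (gaussNodes n).card = n ∧ ∀ x ∈ gaussNodes n, x ∈ Set.Ioo (-1 : ℝ) 1 := by
  obtain ⟨t, ht, hcard, ht0⟩ := exists_zeros_iterate_derivative n le_rfl
  have hsub : t ⊆ gaussNodes n := by
    intro x hx
    rw [gaussNodes, Multiset.mem_toFinset, Polynomial.mem_roots (legendrePoly_ne_zero n),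
      Polynomial.IsRoot, legendrePoly_eq, Polynomial.eval_mul, rodrigues, ht0 x hx, mul_zero]
  have hle : (gaussNodes n).card ≤ n := by
    refine (Multiset.toFinset_card_le _).trans ((Polynomial.card_roots' _).trans ?_)
    rw [legendrePoly_eq]
    exact (Polynomial.natDegree_C_mul_le _ _).trans (rodrigues_natDegree_le n)
  have := Finset.eq_of_subset_of_card_le hsub (by omega)
  subst this
  exact ⟨by omega, ht⟩

theorem rodrigues_eq_C_mul_nodal (n : ℕ) :
    rodrigues n = Polynomial.C ((rodrigues n).coeff n) * Lagrange.nodal (gaussNodes n) id := by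
  obtain ⟨hcard, -⟩ := gaussNodes_spec n
  have hnd : (Lagrange.nodal (gaussNodes n) (id : ℝ → ℝ)).natDegree = n := by
    rw [Lagrange.natDegree_nodal, hcard]
  have hnc : (Lagrange.nodal (gaussNodes n) (id : ℝ → ℝ)).coeff n = 1 := by
    have := (Lagrange.nodal_monic (s := gaussNodes n) (v := (id : ℝ → ℝ))).coeff_natDegree
    rwa [hnd] at this
  rw [← sub_eq_zero]
  refine Polynomial.eq_zero_of_degree_lt_of_eval_finset_eq_zero (gaussNodes n) ?_ ?_
  · rw [hcard, Polynomial.degree_lt_iff_coeff_zero]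
    intro m hm
    rw [Polynomial.coeff_sub, Polynomial.coeff_C_mul]
    rcases hm.eq_or_lt with rfl | hm
    · rw [hnc, mul_one, sub_self]
    · rw [Polynomial.coeff_eq_zero_of_natDegree_lt ((rodrigues_natDegree_le n).trans_lt hm),
        Polynomial.coeff_eq_zero_of_natDegree_lt (hnd.trans_lt hm)]
      simp
  · intro x hx
    have h1 : (Lagrange.nodal (gaussNodes n) (id : ℝ → ℝ)).eval x = 0 :=
      Lagrange.eval_nodal_at_node (v := id) hx
    rw [gaussNodes, Multiset.mem_toFinset, Polynomial.mem_roots (legendrePoly_ne_zero n),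
      Polynomial.IsRoot, legendrePoly_eq, Polynomial.eval_mul, Polynomial.eval_C,
      mul_eq_zero] at hx
    have h2 := hx.resolve_left (by positivity)
    rw [Polynomial.eval_sub, Polynomial.eval_mul, h1, h2]
    simp

theorem unitIntegral_nodal_mul {n : ℕ} {q : Polynomial ℝ} (hq : q.natDegree < n) :
    unitIntegral (Lagrange.nodal (gaussNodes n) id * q) = 0 := by
  have h := unitIntegral_iterate_derivative_mul n le_rfl q
  rw [Polynomial.iterate_derivative_eq_zero hq, mul_zero] at h
  rw [← rodrigues, rodrigues_eq_C_mul_nodal, mul_assoc, unitIntegral_C_mul] at h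
  have h0 : unitIntegral 0 = 0 := by simp [unitIntegral]
  rw [h0, mul_zero] at h
  exact (mul_eq_zero.1 h).resolve_left (rodrigues_coeff_pos n).ne'

/-- One factor of `w^2` is Rodrigues' polynomial up to its leading coefficient; after `n`
integrations by parts the other factor becomes `n!`. -/
theorem unitIntegral_nodal_sq (n : ℕ) :
    unitIntegral (Lagrange.nodal (gaussNodes n) id ^ 2) * ((2 * n).factorial *
      (2 * n + 1).factorial) = 2 ^ (2 * n + 1) * (n.factorial : ℝ) ^ 4 := by
  set w := Lagrange.nodal (gaussNodes n) (id : ℝ → ℝ) with hw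
  have hwn : w.natDegree = n := by rw [hw, Lagrange.natDegree_nodal, (gaussNodes_spec n).1]
  have h := unitIntegral_iterate_derivative_mul n le_rfl w
  rw [iterate_derivative_natDegree_of_monic Lagrange.nodal_monic hwn, ← rodrigues,
    rodrigues_eq_C_mul_nodal, mul_assoc, unitIntegral_C_mul,
    mul_comm _ (Polynomial.C (n.factorial : ℝ)), unitIntegral_C_mul, ← sq, ← hw] at h
  have h2 := unitIntegral_X_sq_sub_one_pow n
  have h3 := rodrigues_coeff n
  rw [← h3]
  calc _ = ((rodrigues n).coeff n * unitIntegral (w ^ 2)) *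
        (n.factorial * (2 * n + 1).factorial) := by ring
    _ = n.factorial ^ 2 * ((-1) ^ n * unitIntegral ((Polynomial.X ^ 2 - 1) ^ n) *
        (2 * n + 1).factorial) := by rw [h]; ring
    _ = _ := by rw [h2]; ring

/-- Divide `p` by the nodal polynomial `w`: the quotient has degree below `n`, hence is orthogonal
to `w`, and the remainder equals its Lagrange interpolant. -/
theorem unitIntegral_eq_sum_basis {n : ℕ} (hn : 0 < n) {p : Polynomial ℝ}
    (hp : p.natDegree < 2 * n) :
    unitIntegral p = ∑ x ∈ gaussNodes n,
      unitIntegral (Lagrange.basis (gaussNodes n) id x) * p.eval x := by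
  obtain ⟨hcard, -⟩ := gaussNodes_spec n
  set w := Lagrange.nodal (gaussNodes n) (id : ℝ → ℝ) with hw
  have hwm : w.Monic := Lagrange.nodal_monic
  have hwn : w.natDegree = n := by rw [hw, Lagrange.natDegree_nodal, hcard]
  have hws : ∀ y ∈ gaussNodes n, w.eval y = 0 := fun y hy =>
    Lagrange.eval_nodal_at_node (v := id) hy
  have hdiv := Polynomial.modByMonic_add_div p w
  have hdeg : (p %ₘ w).degree < (gaussNodes n).card := by
    refine (Polynomial.degree_modByMonic_lt p hwm).trans_le ?_
    rw [hw, Lagrange.degree_nodal]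
  have hq : (p /ₘ w).natDegree < n := by
    rw [Polynomial.natDegree_divByMonic p hwm, hwn]
    omega
  have hr := Lagrange.eq_interpolate (v := (id : ℝ → ℝ)) (Set.injOn_id _) hdeg
  have h1 : unitIntegral p = unitIntegral (p %ₘ w) := by
    conv_lhs => rw [← hdiv, unitIntegral_add, unitIntegral_nodal_mul hq, add_zero]
  rw [h1, hr, Lagrange.interpolate_apply, unitIntegral_sum]
  refine Finset.sum_congr rfl fun x hx => ?_
  rw [unitIntegral_C_mul, mul_comm]
  congr 1
  conv_rhs => rw [← hdiv, Polynomial.eval_add, Polynomial.eval_mul, hws x hx, zero_mul, add_zero]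
  rfl

/-- Write `w = (X - x) e`. The rule is exact for `w' e` and `e^2`, and both vanish at every node
except `x`. Integrating `2 w' e = ((X - x) e^2)' + e^2` then gives `W e(x)^2 = (1 - x) e(1)^2 + (1 +
x) e(-1)^2`. The squared endpoint values of Rodrigues' polynomial determine the right side, and
`w'(x) = e(x)` brings in `P_n'(x)`. -/
theorem gaussWeight_eq_unitIntegral_basis {n : ℕ} {x : ℝ} (hx : x ∈ gaussNodes n) :
    gaussWeight n x = unitIntegral (Lagrange.basis (gaussNodes n) id x) := by
  obtain ⟨hcard, hIoo⟩ := gaussNodes_spec n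
  have hn : 0 < n := by rw [← hcard]; exact Finset.card_pos.2 ⟨x, hx⟩
  set w := Lagrange.nodal (gaussNodes n) (id : ℝ → ℝ) with hw
  set e := Lagrange.nodal ((gaussNodes n).erase x) (id : ℝ → ℝ) with he
  set W := unitIntegral (Lagrange.basis (gaussNodes n) id x) with hW
  have hwe : w = (Polynomial.X - Polynomial.C x) * e := Lagrange.nodal_eq_mul_nodal_erase hx
  have hes : ∀ y ∈ gaussNodes n, y ≠ x → e.eval y = 0 := fun y hy hyx =>
    Lagrange.eval_nodal_at_node (v := id) (Finset.mem_erase.2 ⟨hyx, hy⟩)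
  have hed : e.natDegree = n - 1 := by
    rw [he, Lagrange.natDegree_nodal, Finset.card_erase_of_mem hx, hcard]
  have hex : e.eval x ≠ 0 := by
    rw [he, Lagrange.eval_nodal, Finset.prod_ne_zero_iff]
    intro z hz
    rw [sub_ne_zero]
    exact (Finset.ne_of_mem_erase hz).symm
  have hw' : w.derivative = e + (Polynomial.X - Polynomial.C x) * e.derivative := by
    rw [hwe, Polynomial.derivative_mul]; simp
  have hwx : w.derivative.eval x = e.eval x := by rw [hw']; simp
  have hsum : ∀ q : Polynomial ℝ, (q * e).natDegree < 2 * n →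
      unitIntegral (q * e) = W * (q.eval x * e.eval x) := by
    intro q hq
    rw [unitIntegral_eq_sum_basis hn hq, Finset.sum_eq_single_of_mem x hx, Polynomial.eval_mul]
    intro y hy hyx
    rw [Polynomial.eval_mul, hes y hy hyx, mul_zero, mul_zero]
  have h1 := hsum w.derivative (by
    refine Polynomial.natDegree_mul_le.trans_lt ?_
    have := w.natDegree_derivative_le
    rw [hw, Lagrange.natDegree_nodal, hcard, ← hw] at this
    omega)
  have h2 := hsum e (by
    refine Polynomial.natDegree_mul_le.trans_lt ?_
    omega)
  have h3 := unitIntegral_derivative ((Polynomial.X - Polynomial.C x) * e ^ 2)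
  have h4 : Polynomial.C 2 * (w.derivative * e) =
      ((Polynomial.X - Polynomial.C x) * e ^ 2).derivative + e * e := by
    rw [hw']
    simp only [Polynomial.derivative_mul, Polynomial.derivative_sub, Polynomial.derivative_X,
      Polynomial.derivative_C, Polynomial.derivative_pow]
    simp only [Nat.cast_ofNat, map_ofNat, sub_zero, one_mul, Nat.add_one_sub_one, pow_one]
    ring
  have h5 := congrArg unitIntegral h4
  rw [unitIntegral_C_mul, unitIntegral_add, h1, h2, h3, hwx] at h5
  simp only [Polynomial.eval_mul, Polynomial.eval_sub, Polynomial.eval_X, Polynomial.eval_C,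
    Polynomial.eval_pow] at h5
  set c := (rodrigues n).coeff n with hc
  have hc0 : c ≠ 0 := (rodrigues_coeff_pos n).ne'
  have hrod : rodrigues n = Polynomial.C c * w := rodrigues_eq_C_mul_nodal n
  set B := (2 : ℝ) ^ n * n.factorial with hB
  have hB0 : B ≠ 0 := by positivity
  have h6 := rodrigues_eval_one_sq n
  have h7 := rodrigues_eval_neg_one_sq n
  rw [hrod, hwe] at h6 h7
  simp only [Polynomial.eval_mul, Polynomial.eval_sub, Polynomial.eval_X, Polynomial.eval_C,
    ← hB] at h6 h7
  have hleg : (legendrePoly n).derivative.eval x = c * e.eval x / B := by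
    rw [legendrePoly_eq, hrod]
    simp only [Polynomial.derivative_C_mul, Polynomial.eval_mul, Polynomial.eval_C, hwx, ← hB]
    ring
  obtain ⟨hx1, hx2⟩ := hIoo x hx
  have hp1 : 1 - x ≠ 0 := by linarith
  have hp2 : 1 + x ≠ 0 := by linarith
  have hp3 : 1 - x ^ 2 ≠ 0 := by
    rw [show 1 - x ^ 2 = (1 - x) * (1 + x) by ring]; exact mul_ne_zero hp1 hp2
  have h8 : W * (c * e.eval x) ^ 2 * (1 - x ^ 2) = 2 * B ^ 2 := by
    have : W * e.eval x ^ 2 = (1 - x) * e.eval 1 ^ 2 - (-1 - x) * e.eval (-1) ^ 2 := by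
      linarith
    linear_combination c ^ 2 * (1 - x ^ 2) * this + (1 + x) * h6 + (1 - x) * h7
  rw [gaussWeight, hleg, div_pow]
  rw [eq_comm]
  field_simp
  linear_combination h8

theorem unitIntegral_eq_sum_gaussWeight {n : ℕ} (hn : 0 < n) {p : Polynomial ℝ}
    (hp : p.natDegree < 2 * n) :
    unitIntegral p = ∑ x ∈ gaussNodes n, gaussWeight n x * p.eval x := by
  rw [unitIntegral_eq_sum_basis hn hp]
  exact Finset.sum_congr rfl fun x hx => by rw [gaussWeight_eq_unitIntegral_basis hx]

/-! ### Error and convergence of Gauss quadrature. -/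

/-- The error of Gauss quadrature on `[-1, 1]`. -/
theorem abs_integral_sub_gauss_le {F : ℕ → ℝ → ℝ}
    (hF : ∀ k x, HasDerivAt (F k) (F (k + 1) x) x) {n : ℕ} (hn : 0 < n) {M : ℝ}
    (hM : ∀ x ∈ Set.Icc (-1 : ℝ) 1, |F (2 * n) x| ≤ M) :
    |(∫ x in (-1 : ℝ)..1, F 0 x) - ∑ x ∈ gaussNodes n, gaussWeight n x * F 0 x| ≤
      M / (2 * n).factorial * unitIntegral (Lagrange.nodal (gaussNodes n) id ^ 2) := by
  obtain ⟨hcard, hIoo⟩ := gaussNodes_spec n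
  obtain ⟨H, hHd, hH0, hH1⟩ := exists_hermite_interpolant (gaussNodes n)
    (Finset.card_pos.1 (by omega)) (F 0) (F 1)
  rw [hcard] at hHd
  have hc : Continuous (F 0) := continuous_iff_continuousAt.2 fun x => (hF 0 x).continuousAt
  have hsum : ∑ x ∈ gaussNodes n, gaussWeight n x * F 0 x = unitIntegral H := by
    rw [unitIntegral_eq_sum_gaussWeight hn hHd]
    exact Finset.sum_congr rfl fun x hx => by rw [hH0 x hx]
  rw [hsum, unitIntegral, ← intervalIntegral.integral_sub (hc.intervalIntegrable _ _)
    (H.continuous.intervalIntegrable _ _), unitIntegral, ← intervalIntegral.integral_const_mul,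
    ← Real.norm_eq_abs]
  refine intervalIntegral.norm_integral_le_of_norm_le (by norm_num) ?_
    (Continuous.intervalIntegrable (by fun_prop) _ _)
  refine Filter.Eventually.of_forall fun x hx => ?_
  rw [Polynomial.eval_pow, Real.norm_eq_abs]
  exact abs_sub_hermite_le hF hcard hn (fun y hy => Set.Ioo_subset_Icc_self (hIoo y hy)) hM hHd
    hH0 hH1 (Set.Ioc_subset_Icc_self hx)

theorem gaussWeight_nonneg {n : ℕ} {x : ℝ} (hx : x ∈ gaussNodes n) : 0 ≤ gaussWeight n x := by
  obtain ⟨h1, h2⟩ := (gaussNodes_spec n).2 x hx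
  have : 0 ≤ 1 - x ^ 2 := by nlinarith
  rw [gaussWeight]
  positivity

theorem sum_gaussWeight {n : ℕ} (hn : 0 < n) : ∑ x ∈ gaussNodes n, gaussWeight n x = 2 := by
  have h := unitIntegral_eq_sum_gaussWeight hn (p := 1) (by simp; omega)
  simp only [Polynomial.eval_one, mul_one, unitIntegral] at h
  rw [← h]
  norm_num

/-- Gauss quadrature converges for continuous functions. -/
theorem tendsto_gauss {f : ℝ → ℝ} (hf : Continuous f) :
    Filter.Tendsto (fun n => (∫ x in (-1 : ℝ)..1, f x) -
      ∑ x ∈ gaussNodes n, gaussWeight n x * f x) Filter.atTop (nhds 0) := by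
  rw [Metric.tendsto_atTop]
  intro ε hε
  -- The integral and the rule (nonnegative weights of sum 2) each change by at most `2 * ε / 8`
  -- when `f` is replaced by `p`, for which the rule is exact once `n > deg p`.
  obtain ⟨p, hp⟩ := exists_polynomial_near_of_continuousOn (-1) 1 f hf.continuousOn (ε / 8)
    (by positivity)
  refine ⟨p.natDegree + 1, fun n hn => ?_⟩
  have hn0 : 0 < n := by omega
  have hex := unitIntegral_eq_sum_gaussWeight hn0 (p := p) (by omega)
  have h1 : |(∫ x in (-1 : ℝ)..1, f x) - unitIntegral p| ≤ ε / 8 * 2 := by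
    rw [unitIntegral, ← intervalIntegral.integral_sub (hf.intervalIntegrable _ _)
      (p.continuous.intervalIntegrable _ _), ← Real.norm_eq_abs]
    have := intervalIntegral.norm_integral_le_of_norm_le_const (a := (-1 : ℝ)) (b := 1)
      (f := fun x => f x - p.eval x) (C := ε / 8) (by
        intro x hx
        rw [Set.uIoc_of_le (by norm_num)] at hx
        rw [Real.norm_eq_abs, abs_sub_comm]
        exact (hp x (Set.Ioc_subset_Icc_self hx)).le)
    norm_num at this ⊢
    linarith
  have h2 : |unitIntegral p - ∑ x ∈ gaussNodes n, gaussWeight n x * f x| ≤ ε / 8 * 2 := by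
    rw [hex, ← Finset.sum_sub_distrib, ← sum_gaussWeight hn0, Finset.mul_sum]
    refine (Finset.abs_sum_le_sum_abs _ _).trans (Finset.sum_le_sum fun x hx => ?_)
    rw [← mul_sub, abs_mul, abs_of_nonneg (gaussWeight_nonneg hx), mul_comm]
    exact mul_le_mul_of_nonneg_right
      (hp x (Set.Ioo_subset_Icc_self ((gaussNodes_spec n).2 x hx))).le (gaussWeight_nonneg hx)
  rw [Real.dist_eq, sub_zero]
  calc _ = |((∫ x in (-1 : ℝ)..1, f x) - unitIntegral p) +
        (unitIntegral p - ∑ x ∈ gaussNodes n, gaussWeight n x * f x)| := by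
        congr 1; ring
    _ ≤ ε / 8 * 2 + ε / 8 * 2 := (abs_add_le _ _).trans (add_le_add h1 h2)
    _ < ε := by linarith

/-- Induction by `(n+1) C_{n+1} = 2(2n+1) C_n` for the central binomials, with `4n(n+1) ≤ (2n+1)^2`.
-/
theorem sixteen_pow_le_centralBinom_sq {n : ℕ} (hn : 0 < n) :
    16 ^ n ≤ 4 * n * n.centralBinom ^ 2 := by
  induction n, hn using Nat.le_induction with
  | base => simp [Nat.centralBinom]
  | succ n hn ih =>
    have h := Nat.succ_mul_centralBinom_succ n
    have h2 : (n + 1) * 16 ^ (n + 1) ≤ (n + 1) * (4 * (n + 1) * (n + 1).centralBinom ^ 2) := by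
      calc (n + 1) * 16 ^ (n + 1) = 16 * (n + 1) * 16 ^ n := by ring
        _ ≤ 16 * (n + 1) * (4 * n * n.centralBinom ^ 2) := Nat.mul_le_mul_left _ ih
        _ = 4 * (4 * n * (n + 1)) * (4 * n.centralBinom ^ 2) := by ring
        _ ≤ 4 * (2 * n + 1) ^ 2 * (4 * n.centralBinom ^ 2) := by gcongr; nlinarith
        _ = 4 * (2 * (2 * n + 1) * n.centralBinom) ^ 2 := by ring
        _ = 4 * ((n + 1) * (n + 1).centralBinom) ^ 2 := by rw [h]
        _ = _ := by ring
    exact Nat.le_of_mul_le_mul_left h2 (by omega)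

theorem unitIntegral_nodal_sq_le {n : ℕ} (hn : 0 < n) :
    unitIntegral (Lagrange.nodal (gaussNodes n) id ^ 2) * (2 * n + 1) ≤
      2 ^ (2 * n) * (8 * n / 16 ^ n) := by
  have h := unitIntegral_nodal_sq n
  have hb : (n.centralBinom : ℝ) * (n.factorial : ℝ) ^ 2 = (2 * n).factorial := by
    have := Nat.choose_mul_factorial_mul_factorial (show n ≤ 2 * n by omega)
    rw [show 2 * n - n = n by omega] at this
    rw [Nat.centralBinom, ← this]
    push_cast; ring
  have h16 : (16 : ℝ) ^ n ≤ 4 * n * (n.centralBinom : ℝ) ^ 2 := by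
    exact_mod_cast sixteen_pow_le_centralBinom_sq hn
  rw [Nat.factorial_succ, ← hb] at h
  push_cast at h
  have hf : (0 : ℝ) < (n.factorial : ℝ) ^ 4 := by positivity
  set I := unitIntegral (Lagrange.nodal (gaussNodes n) id ^ 2)
  have h2 : I * (2 * n + 1) * (n.centralBinom : ℝ) ^ 2 = 2 ^ (2 * n + 1) := by
    rw [← hb] at h
    apply mul_right_cancel₀ hf.ne'
    linear_combination h
  have hcb : (0 : ℝ) < (n.centralBinom : ℝ) ^ 2 := by
    have := n.centralBinom_pos
    positivity
  rw [← mul_le_mul_iff_left₀ hcb, h2, pow_succ]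
  have h3 : 1 ≤ 4 * n * (n.centralBinom : ℝ) ^ 2 / 16 ^ n := by
    rw [le_div_iff₀ (by positivity)]; linarith
  calc (2 : ℝ) ^ (2 * n) * 2 = 2 ^ (2 * n) * 2 * 1 := by ring
    _ ≤ 2 ^ (2 * n) * 2 * (4 * n * (n.centralBinom : ℝ) ^ 2 / 16 ^ n) := by gcongr
    _ = _ := by ring

/-! ### Bounds for the kernel in a complex strip. -/

/-- With `θ = arg w`, weighted AM-GM and concavity of cosine give `(cos θ)^β ≤ β cos θ + 1 - β ≤ cos
(β θ)`, so `Re (w^β) ≥ (Re w)^β`. -/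
theorem one_le_re_cpow {β : ℝ} (hβ0 : 0 < β) (hβ1 : β < 1) {w : ℂ} (hw : 1 ≤ w.re) :
    1 ≤ (w ^ (β : ℂ)).re := by
  rw [Complex.cpow_ofReal_re]
  have harg := Complex.abs_arg_lt_pi_div_two_iff.2 (Or.inl (by linarith : 0 < w.re))
  obtain ⟨h1, h2⟩ := abs_lt.1 harg
  have hcos : 0 < Real.cos w.arg := Real.cos_pos_of_mem_Ioo ⟨h1, h2⟩
  have hre : ‖w‖ * Real.cos w.arg = w.re := Complex.norm_mul_cos_arg w
  have hconc := strictConcaveOn_cos_Icc.concaveOn.2 (x := w.arg) (y := 0)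
    ⟨h1.le, h2.le⟩ ⟨by linarith [Real.pi_pos], by linarith [Real.pi_pos]⟩ hβ0.le
    (by linarith : 0 ≤ 1 - β) (by ring)
  simp only [smul_eq_mul, mul_zero, add_zero, Real.cos_zero, mul_one] at hconc
  have hamgm := Real.geom_mean_le_arith_mean2_weighted hβ0.le (by linarith : 0 ≤ 1 - β)
    hcos.le zero_le_one (by ring)
  rw [Real.one_rpow, mul_one, mul_one] at hamgm
  calc (1 : ℝ) ≤ w.re ^ β := Real.one_le_rpow hw hβ0.le
    _ = ‖w‖ ^ β * Real.cos w.arg ^ β := by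
      rw [← hre, Real.mul_rpow (norm_nonneg _) hcos.le]
    _ ≤ ‖w‖ ^ β * Real.cos (w.arg * β) := by
      rw [mul_comm w.arg β]
      exact mul_le_mul_of_nonneg_left (hamgm.trans hconc) (Real.rpow_nonneg (norm_nonneg _) _)

theorem re_cpow_nonneg {β : ℝ} (hβ0 : 0 < β) (hβ1 : β < 1) {w : ℂ} (hw : 0 < w.re) :
    0 ≤ (w ^ (β : ℂ)).re := by
  rw [Complex.cpow_ofReal_re]
  have harg := Complex.abs_arg_lt_pi_div_two_iff.2 (Or.inl hw)
  refine mul_nonneg (Real.rpow_nonneg (norm_nonneg _) _)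
    (Real.cos_nonneg_of_mem_Icc (abs_le.1 ?_))
  rw [abs_mul, abs_of_pos hβ0]
  nlinarith [abs_nonneg w.arg]

theorem normConst_pos (β : ℝ) : 0 < normConst β := by
  have := Real.pi_pos
  rw [normConst]
  positivity

/-- The holomorphic extension of `kernel`. -/
noncomputable def complexKernel (β : ℝ) (z : ℂ) : ℂ :=
  1 / ((normConst β : ℂ) * (1 - Complex.I * z) *
    Complex.exp ((1 + Complex.I * z) ^ (β : ℂ)))

theorem differentiableAt_complexKernel (β : ℝ) {z : ℂ} (hz : |z.im| < 1) :
    DifferentiableAt ℂ (complexKernel β) z := by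
  obtain ⟨h1, h2⟩ := abs_lt.1 hz
  have hs : 1 + Complex.I * z ∈ Complex.slitPlane := by
    left; simp; linarith
  have h0 : (1 - Complex.I * z) ≠ 0 := by
    intro h
    have := congrArg Complex.re h
    simp at this
    linarith
  have hd : DifferentiableAt ℂ (fun z : ℂ => (1 + Complex.I * z) ^ (β : ℂ)) z :=
    DifferentiableAt.cpow_const (by fun_prop) hs
  unfold complexKernel
  refine DifferentiableAt.div (by fun_prop) (by fun_prop) ?_
  refine mul_ne_zero (mul_ne_zero ?_ h0) (Complex.exp_ne_zero _)
  exact_mod_cast (normConst_pos β).ne'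

theorem norm_complexKernel_le {β : ℝ} (hβ0 : 0 < β) (hβ1 : β < 1) {n : ℕ} (hn : 2 ≤ n) {z : ℂ}
    (hz : |z.im| ≤ n / (n + 1)) :
    ‖complexKernel β z‖ ≤ (n + 1) / (Real.exp 1 * normConst β) := by
  obtain ⟨h1, h2⟩ := abs_le.1 hz
  have hC := normConst_pos β
  have hn1 : (0 : ℝ) < n + 1 := by positivity
  have hq : (n : ℝ) / (n + 1) = 1 - 1 / (n + 1) := by field_simp; ring
  have hq0 : (0 : ℝ) < 1 / (n + 1) := by positivity
  have hre : (1 - Complex.I * z).re = 1 + z.im := by simp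
  have hrew : (1 + Complex.I * z).re = 1 - z.im := by simp; ring
  have hu := Complex.re_le_norm (1 - Complex.I * z)
  rw [hre] at hu
  have key : Real.exp 1 / (n + 1) ≤
      ‖1 - Complex.I * z‖ * Real.exp ((1 + Complex.I * z) ^ (β : ℂ)).re := by
    -- Below the real axis the exponential supplies `e` and `|1 - iz| ≥ 1/(n+1)`. Above it both
    -- factors are at least 1, and `e ≤ 3 ≤ n + 1`.
    rcases le_total z.im 0 with hi | hi
    · have h3 := one_le_re_cpow hβ0 hβ1 (w := 1 + Complex.I * z) (by linarith)
      calc Real.exp 1 / (n + 1) = 1 / (n + 1) * Real.exp 1 := by ring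
        _ ≤ _ := mul_le_mul (by linarith) (Real.exp_le_exp.2 h3) (Real.exp_pos _).le
          (norm_nonneg _)
    · have h3 := re_cpow_nonneg hβ0 hβ1 (w := 1 + Complex.I * z) (by linarith)
      have hn' : (2 : ℝ) ≤ n := by exact_mod_cast hn
      calc Real.exp 1 / (n + 1) ≤ 1 := by
            rw [div_le_one hn1]; linarith [Real.exp_one_lt_d9]
        _ = 1 * 1 := by ring
        _ ≤ _ := mul_le_mul (by linarith) (Real.one_le_exp h3) zero_le_one (norm_nonneg _)
  rw [complexKernel, norm_div, norm_mul, norm_mul, Complex.norm_exp, norm_one, Complex.norm_real,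
    Real.norm_eq_abs, abs_of_pos hC]
  calc 1 / (normConst β * ‖1 - Complex.I * z‖ * Real.exp ((1 + Complex.I * z) ^ (β : ℂ)).re)
      = 1 / (normConst β *
        (‖1 - Complex.I * z‖ * Real.exp ((1 + Complex.I * z) ^ (β : ℂ)).re)) := by rw [mul_assoc]
    _ ≤ 1 / (normConst β * (Real.exp 1 / (n + 1))) := by
      apply one_div_le_one_div_of_le
      · positivity
      · exact mul_le_mul_of_nonneg_left key hC.le
    _ = _ := by field_simp

/-! ### Growth of the propagator off the real axis. -/

/-- The exponential bound given by the numerical abscissa. -/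
theorem norm_exp_le_of_re_inner_le {E : Type*} [NormedAddCommGroup E] [InnerProductSpace ℂ E]
    [CompleteSpace E] (X : E →L[ℂ] E) {b : ℝ} (hX : ∀ v, (inner ℂ v (X v)).re ≤ b * ‖v‖ ^ 2) :
    ‖NormedSpace.exp X‖ ≤ Real.exp b := by
  refine ContinuousLinearMap.opNorm_le_bound _ (Real.exp_pos b).le fun v => ?_
  let _ : InnerProductSpace ℝ E := InnerProductSpace.rclikeToReal ℂ E
  set u : ℝ → E := fun s => NormedSpace.exp (s • X) v with hu
  have hu' : ∀ s, HasDerivAt u (X (u s)) s := fun s => by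
    have h := hasDerivAt_exp_smul_const' (𝕂 := ℝ) X s
    exact ((ContinuousLinearMap.apply ℂ E v).restrictScalars ℝ).hasFDerivAt.comp_hasDerivAt s h
  -- The numerical abscissa bound makes `e^(-2bs) ‖u s‖^2` nonincreasing; comparing `s = 0` with `s
  -- = 1` gives the claim.
  have hd : ∀ s, HasDerivAt (fun s => Real.exp (-(2 * b) * s) * ‖u s‖ ^ 2)
      (Real.exp (-(2 * b) * s) * (2 * ((inner ℂ (u s) (X (u s))).re - b * ‖u s‖ ^ 2))) s := by
    intro s
    have h1 : HasDerivAt (fun s => Real.exp (-(2 * b) * s)) _ s :=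
      ((hasDerivAt_id s).const_mul (-(2 * b))).exp
    have h2 := h1.mul (hu' s).norm_sq
    refine h2.congr_deriv ?_
    have : inner ℝ (u s) (X (u s)) = (inner ℂ (u s) (X (u s))).re := rfl
    rw [this, id_eq]
    ring
  have hanti := antitone_of_hasDerivAt_nonpos hd fun s =>
    mul_nonpos_of_nonneg_of_nonpos (Real.exp_pos _).le (by linarith [hX (u s)])
  have h01 := hanti zero_le_one
  simp only [hu, one_smul, zero_smul, NormedSpace.exp_zero, mul_zero, Real.exp_zero, mul_one,
    one_mul] at h01
  rw [Real.exp_neg, inv_mul_le_iff₀ (Real.exp_pos _), show (2 * b) = b + b by ring,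
    Real.exp_add] at h01
  refine le_of_sq_le_sq ?_ (by positivity)
  calc _ ≤ _ := h01
    _ = _ := by simp; ring

/-- The entire extension of `propagator` in the variable `k`. -/
noncomputable def complexPropagator {d : ℕ} (L H : Matrix (Fin d) (Fin d) ℂ) (t : ℝ) (z : ℂ) :
    Matrix (Fin d) (Fin d) ℂ :=
  NormedSpace.exp ((-(Complex.I * (t : ℂ))) • (z • L + H))

theorem differentiable_complexPropagator {d : ℕ} (L H : Matrix (Fin d) (Fin d) ℂ) (t : ℝ) :
    Differentiable ℂ (complexPropagator L H t) := by
  have h : Differentiable ℂ (NormedSpace.exp : Matrix (Fin d) (Fin d) ℂ → _) := fun x =>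
    (NormedSpace.exp_analytic (𝕂 := ℂ) x).differentiableAt
  exact h.comp (by fun_prop)

theorem norm_complexPropagator_le {d : ℕ} {L H : Matrix (Fin d) (Fin d) ℂ} (hL : L.IsHermitian)
    (hH : H.IsHermitian) {t : ℝ} (ht : 0 ≤ t) (z : ℂ) :
    ‖complexPropagator L H t z‖ ≤ Real.exp (t * ‖L‖ * |z.im|) := by
  set T := Matrix.toEuclideanCLM (n := Fin d) (𝕜 := ℂ)
  have hcont : Continuous T :=
    LinearMap.continuous_of_finiteDimensional
      (T.toAlgEquiv.toLinearMap : Matrix (Fin d) (Fin d) ℂ →ₗ[ℂ] _)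
  have hTL : IsSelfAdjoint (T L) := IsSelfAdjoint.map (hL : IsSelfAdjoint L) T
  have hTH : IsSelfAdjoint (T H) := IsSelfAdjoint.map (hH : IsSelfAdjoint H) T
  rw [Matrix.cstar_norm_def, complexPropagator]
  change ‖T _‖ ≤ _
  let _ : NormedAlgebra ℚ (Matrix (Fin d) (Fin d) ℂ) := NormedAlgebra.restrictScalars ℚ ℂ _
  rw [NormedSpace.map_exp T hcont]
  refine norm_exp_le_of_re_inner_le _ fun v => ?_
  have e : ∀ A : EuclideanSpace ℂ (Fin d) →L[ℂ] EuclideanSpace ℂ (Fin d), IsSelfAdjoint A →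
      (inner ℂ v (A v)).im = 0 := fun A hA => by
    have := (ContinuousLinearMap.isSelfAdjoint_iff_isSymmetric.1 hA).im_inner_self_apply v
    simpa using this
  have hLv : |(inner ℂ v (T L v)).re| ≤ ‖L‖ * ‖v‖ ^ 2 := by
    refine (Complex.abs_re_le_norm _).trans ((norm_inner_le_norm _ _).trans ?_)
    have := (T L).le_opNorm v
    rw [show ‖T L‖ = ‖L‖ from (Matrix.cstar_norm_def L).symm] at this
    nlinarith [norm_nonneg v]
  -- Since `L` and `H` are self-adjoint, only the imaginary part of `z` contributes to the real
  -- part.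
  have : (inner ℂ v (T (-(Complex.I * t) • (z • L + H)) v)).re =
      t * (z.im * (inner ℂ v (T L v)).re) := by
    simp only [map_smul, map_add, smul_apply, add_apply,
      inner_smul_right, inner_add_right]
    simp [e _ hTL, e _ hTH]
  rw [this]
  calc _ ≤ t * (|z.im| * |(inner ℂ v (T L v)).re|) := by
        rw [← abs_mul]; exact mul_le_mul_of_nonneg_left (le_abs_self _) ht
    _ ≤ t * (|z.im| * (‖L‖ * ‖v‖ ^ 2)) := by gcongr
    _ = _ := by ring

/-! ### Cauchy estimates for the integrand. -/

/-- The integrand `g(z) U(t, z)`, tested against a continuous functional. -/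
noncomputable def testedIntegrand {d : ℕ} (φ : Matrix (Fin d) (Fin d) ℂ →L[ℂ] ℂ)
    (L H : Matrix (Fin d) (Fin d) ℂ) (β t : ℝ) (z : ℂ) : ℂ :=
  complexKernel β z * φ (complexPropagator L H t z)

theorem isOpen_strip : IsOpen {z : ℂ | |z.im| < 1} :=
  isOpen_lt (by fun_prop) continuous_const

theorem differentiableOn_testedIntegrand {d : ℕ} (φ : Matrix (Fin d) (Fin d) ℂ →L[ℂ] ℂ)
    (L H : Matrix (Fin d) (Fin d) ℂ) (β t : ℝ) :
    DifferentiableOn ℂ (testedIntegrand φ L H β t) {z : ℂ | |z.im| < 1} := fun z hz =>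
  ((differentiableAt_complexKernel β hz).mul
    (φ.differentiableAt.comp z (differentiable_complexPropagator L H t z))).differentiableWithinAt

theorem hasDerivAt_iteratedDeriv_of_differentiableOn {G : ℂ → ℂ} {S : Set ℂ} (hS : IsOpen S)
    (hG : DifferentiableOn ℂ G S) (k : ℕ) {z : ℂ} (hz : z ∈ S) :
    HasDerivAt (iteratedDeriv k G) (iteratedDeriv (k + 1) G z) z := by
  have h : ∀ k, DifferentiableOn ℂ (iteratedDeriv k G) S := fun k => by
    induction k with
    | zero => rwa [iteratedDeriv_zero]
    | succ k ih => rw [iteratedDeriv_succ]; exact ih.deriv hS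
  rw [iteratedDeriv_succ]
  exact ((h k).differentiableAt (hS.mem_nhds hz)).hasDerivAt

/-- The successive derivatives of `x ↦ Re G(a x + c)`. -/
theorem hasDerivAt_re_iteratedDeriv_affine {G : ℂ → ℂ}
    (hG : DifferentiableOn ℂ G {z : ℂ | |z.im| < 1}) (a c : ℝ) (k : ℕ) (x : ℝ) :
    HasDerivAt (fun x : ℝ => a ^ k * (iteratedDeriv k G ((a * x + c : ℝ) : ℂ)).re)
      (a ^ (k + 1) * (iteratedDeriv (k + 1) G ((a * x + c : ℝ) : ℂ)).re) x := by
  have h1 := (hasDerivAt_iteratedDeriv_of_differentiableOn isOpen_strip hG k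
    (z := ((a * x + c : ℝ) : ℂ)) (by simp [-Complex.ofReal_add, -Complex.ofReal_mul])).real_of_complex
  have h2 : HasDerivAt (fun x : ℝ => a * x + c) a x := by
    simpa using ((hasDerivAt_id x).const_mul a).add_const c
  refine ((h1.comp x h2).const_mul (a ^ k)).congr_deriv ?_
  ring

theorem norm_iteratedDeriv_testedIntegrand_le {d : ℕ} {φ : Matrix (Fin d) (Fin d) ℂ →L[ℂ] ℂ}
    (hφ : ‖φ‖ ≤ 1) {L H : Matrix (Fin d) (Fin d) ℂ} (hL : L.IsHermitian) (hH : H.IsHermitian)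
    {β : ℝ} (hβ0 : 0 < β) (hβ1 : β < 1) {t : ℝ} (ht : 0 < t) {h : ℝ} (hh : 0 < h) (hh1 : h ≤ 1)
    (hLh : t * ‖L‖ * h ≤ 1 / Real.exp 1) {n : ℕ} (hn : 2 ≤ n) (k : ℝ) :
    h ^ n * ‖iteratedDeriv n (testedIntegrand φ L H β t) k‖ ≤
      n.factorial * (Real.exp (1 / Real.exp 1) * (n + 1) / normConst β) := by
  have hC := normConst_pos β
  have hn0 : (0 : ℝ) < n := by positivity
  set r : ℝ := n / (n + 1) with hr
  have hr0 : 0 < r := by positivity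
  have hr1 : r < 1 := by rw [hr, div_lt_one (by positivity)]; linarith
  have him : ∀ z ∈ Metric.closedBall (k : ℂ) (h * r), |z.im| ≤ h * r := fun z hz => by
    have := (Complex.abs_im_le_norm (z - k)).trans (mem_closedBall_iff_norm.1 hz)
    simpa using this
  have hhr : h * r ≤ r := by nlinarith
  have hcauchy := Complex.norm_iteratedDeriv_le_of_forall_mem_sphere_norm_le
    (f := testedIntegrand φ L H β t) (c := (k : ℂ)) (R := h * r)
    (C := (n + 1) / (Real.exp 1 * normConst β) * Real.exp (1 / Real.exp 1)) n (by positivity) (by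
      refine ((differentiableOn_testedIntegrand φ L H β t).mono fun z hz => ?_).diffContOnCl
      rw [closure_ball _ (by positivity)] at hz
      exact (him z hz).trans_lt (hhr.trans_lt hr1)) (by
      intro z hz
      have hz' := him z (Metric.sphere_subset_closedBall hz)
      rw [testedIntegrand, norm_mul]
      refine mul_le_mul (norm_complexKernel_le hβ0 hβ1 hn (hz'.trans hhr)) ?_ (norm_nonneg _)
        (by positivity)
      refine (φ.le_opNorm _).trans ?_
      calc _ ≤ 1 * Real.exp (t * ‖L‖ * |z.im|) :=
            mul_le_mul hφ (norm_complexPropagator_le hL hH ht.le z) (norm_nonneg _) zero_le_one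
        _ ≤ _ := by
          rw [one_mul]
          refine Real.exp_le_exp.2 (le_trans ?_ hLh)
          refine mul_le_mul_of_nonneg_left (hz'.trans ?_) (by positivity)
          nlinarith)
  -- `r^(-n) = (1 + 1/n)^n ≤ e` absorbs the `1/e` of the kernel bound; this is why the radius is `h
  -- n / (n+1)`.
  have he : 1 / r ^ n ≤ Real.exp 1 := by
    have h1 : 1 / r = 1 + 1 / n := by rw [hr]; field_simp
    rw [← one_div_pow, h1]
    calc (1 + 1 / (n : ℝ)) ^ n ≤ Real.exp (1 / n) ^ n := by
          gcongr
          linarith [Real.add_one_le_exp (1 / (n : ℝ))]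
      _ = Real.exp 1 := by
          rw [← Real.exp_nat_mul]; congr 1; field_simp
  calc _ ≤ h ^ n * (n.factorial * ((n + 1) / (Real.exp 1 * normConst β) *
        Real.exp (1 / Real.exp 1)) / (h * r) ^ n) :=
        mul_le_mul_of_nonneg_left hcauchy (by positivity)
    _ = n.factorial * (Real.exp (1 / Real.exp 1) * (n + 1) / normConst β) / Real.exp 1 *
        (1 / r ^ n) := by
        rw [mul_pow]; field_simp
    _ ≤ n.factorial * (Real.exp (1 / Real.exp 1) * (n + 1) / normConst β) / Real.exp 1 *
        Real.exp 1 := by gcongr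
    _ = _ := by field_simp

/-! ### From the matrix error to scalar quadrature and back. -/

theorem sum_integral_subintervals {f : ℝ → ℂ} (hf : Continuous f) (h : ℝ) (N : ℕ) :
    ∑ m ∈ Finset.Ico (-(N : ℤ)) (N : ℤ), (∫ k in (m * h)..((m + 1) * h), f k) =
      ∫ k in (-(N * h))..(N * h), f k := by
  have hi : ∀ a b, IntervalIntegrable f MeasureTheory.volume a b := fun a b =>
    hf.intervalIntegrable a b
  induction N with
  | zero => simp
  | succ N ih =>
    have hset : Finset.Ico (-((N + 1 : ℕ) : ℤ)) ((N + 1 : ℕ) : ℤ) =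
        insert (-((N : ℤ) + 1)) (insert (N : ℤ) (Finset.Ico (-(N : ℤ)) (N : ℤ))) := by
      ext m; simp only [Finset.mem_Ico, Finset.mem_insert]; omega
    rw [hset, Finset.sum_insert (by simp), Finset.sum_insert (by simp), ih]
    push_cast
    rw [show (-((N : ℝ) + 1) + 1) * h = -(N * h) by ring,
      show -((N : ℝ) + 1) * h = -((N + 1) * h) by ring,
      add_comm (∫ k in (N * h)..((N + 1) * h), f k),
      intervalIntegral.integral_add_adjacent_intervals (hi _ _) (hi _ _),
      intervalIntegral.integral_add_adjacent_intervals (hi _ _) (hi _ _)]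

theorem continuous_kernel_smul_propagator {d : ℕ} (L H : Matrix (Fin d) (Fin d) ℂ) (β t : ℝ) :
    Continuous fun k => kernel β k • propagator L H t k := by
  have h1 : Continuous (kernel β) := continuous_iff_continuousAt.2 fun k =>
    ((differentiableAt_complexKernel β (z := k) (by simp)).continuousAt).comp
      Complex.continuous_ofReal.continuousAt
  have h2 : Continuous (propagator L H t) :=
    (differentiable_complexPropagator L H t).continuous.comp Complex.continuous_ofReal
  exact h1.smul h2

/-- The quadrature error, tested against a continuous functional. -/
theorem re_apply_error {d : ℕ} (φ : Matrix (Fin d) (Fin d) ℂ →L[ℂ] ℂ)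
    (L H : Matrix (Fin d) (Fin d) ℂ) (β t : ℝ) {K h : ℝ} {N : ℕ}
    (hK : K = N * h) (Q : ℕ) :
    (φ ((∫ k in (-K)..K, kernel β k • propagator L H t k) - lchsQuadrature L H β t h N Q)).re =
      ∑ m ∈ Finset.Ico (-(N : ℤ)) (N : ℤ), h / 2 *
        ((∫ x in (-1 : ℝ)..1, (testedIntegrand φ L H β t (subNode h m x : ℝ)).re) -
          ∑ x ∈ gaussNodes Q, gaussWeight Q x *
            (testedIntegrand φ L H β t (subNode h m x : ℝ)).re) := by
  set G : ℝ → ℂ := fun k => testedIntegrand φ L H β t k with hG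
  have hφ : ∀ k, φ (kernel β k • propagator L H t k) = G k := fun k => by
    rw [map_smul, smul_eq_mul]; rfl
  have hcont := continuous_kernel_smul_propagator L H β t
  have hGc : Continuous G := (φ.continuous.comp hcont).congr hφ
  have hint : φ (∫ k in (-K)..K, kernel β k • propagator L H t k) =
      ∑ m ∈ Finset.Ico (-(N : ℤ)) (N : ℤ), ∫ k in (m * h)..((m + 1) * h), G k := by
    rw [← ContinuousLinearMap.intervalIntegral_comp_comm φ (hcont.intervalIntegrable _ _),
      sum_integral_subintervals hGc, hK]
    simp only [hφ]
  have hsub : ∀ m : ℤ, (∫ k in (m * h)..((m + 1) * h), G k).re =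
      h / 2 * ∫ x in (-1 : ℝ)..1, (G (subNode h m x)).re := fun m => by
    have h1 : (∫ k in (m * h)..((m + 1) * h), G k).re =
        ∫ k in (m * h)..((m + 1) * h), (G k).re := by
      exact (ContinuousLinearMap.intervalIntegral_comp_comm Complex.reCLM
        (hGc.intervalIntegrable _ _)).symm
    have h2 := intervalIntegral.mul_integral_comp_mul_add (a := (-1 : ℝ)) (b := 1)
      (f := fun k => (G k).re) (h / 2) ((2 * m + 1) * h / 2)
    rw [h1]
    simp only [subNode]
    rw [h2]
    congr 1 <;> ring
  rw [map_sub, Complex.sub_re, hint, Complex.re_sum, lchsQuadrature, map_sum, Complex.re_sum,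
    ← Finset.sum_sub_distrib]
  refine Finset.sum_congr rfl fun m _ => ?_
  rw [hsub, mul_sub, map_sum, Complex.re_sum, Finset.mul_sum]
  congr 1
  refine Finset.sum_congr rfl fun x _ => ?_
  rw [mul_smul, map_smul, hφ, smul_eq_mul, Complex.re_ofReal_mul, mul_assoc]

theorem abs_re_gauss_error_le {d : ℕ} {φ : Matrix (Fin d) (Fin d) ℂ →L[ℂ] ℂ}
    (hφ : ‖φ‖ ≤ 1) {L H : Matrix (Fin d) (Fin d) ℂ} (hL : L.IsHermitian) (hH : H.IsHermitian)
    {β : ℝ} (hβ0 : 0 < β) (hβ1 : β < 1) {t : ℝ} (ht : 0 < t) {h : ℝ} (hh : 0 < h) (hh1 : h ≤ 1)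
    (hLh : t * ‖L‖ * h ≤ 1 / Real.exp 1) {Q : ℕ} (hQ : 0 < Q) (m : ℤ) :
    |(∫ x in (-1 : ℝ)..1, (testedIntegrand φ L H β t (subNode h m x : ℝ)).re) -
      ∑ x ∈ gaussNodes Q, gaussWeight Q x * (testedIntegrand φ L H β t (subNode h m x : ℝ)).re| ≤
      Real.exp (1 / Real.exp 1) / normConst β * (8 * Q / 16 ^ Q) := by
  have hC := normConst_pos β
  set G := testedIntegrand φ L H β t
  set A := Real.exp (1 / Real.exp 1)
  set F : ℕ → ℝ → ℝ := fun k x => (h / 2) ^ k *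
    (iteratedDeriv k G ((h / 2 * x + (2 * m + 1) * h / 2 : ℝ) : ℂ)).re with hF
  have hF' : ∀ k x, HasDerivAt (F k) (F (k + 1) x) x := fun k x =>
    hasDerivAt_re_iteratedDeriv_affine (differentiableOn_testedIntegrand φ L H β t) _ _ k x
  have hF0 : ∀ x, F 0 x = (G (subNode h m x : ℝ)).re := fun x => by
    simp [hF, subNode, iteratedDeriv_zero]
  have hM : ∀ x ∈ Set.Icc (-1 : ℝ) 1, |F (2 * Q) x| ≤
      (2 * Q).factorial * (A * (2 * Q + 1) / normConst β) / 2 ^ (2 * Q) := fun x _ => by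
    have := norm_iteratedDeriv_testedIntegrand_le hφ hL hH hβ0 hβ1 ht hh hh1 hLh
      (n := 2 * Q) (by omega) (h / 2 * x + (2 * m + 1) * h / 2)
    push_cast at this
    rw [hF, abs_mul, abs_of_pos (show 0 < (h / 2) ^ (2 * Q) by positivity), div_pow,
      div_mul_eq_mul_div]
    refine div_le_div_of_nonneg_right (le_trans ?_ this) (by positivity)
    have hre := mul_le_mul_of_nonneg_left (Complex.abs_re_le_norm
      (iteratedDeriv (2 * Q) G ((h / 2 * x + (2 * m + 1) * h / 2 : ℝ) : ℂ)))
      (pow_nonneg hh.le (2 * Q))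
    push_cast at hre ⊢
    exact hre
  have herr := abs_integral_sub_gauss_le hF' hQ hM
  simp only [hF0] at herr
  refine herr.trans ?_
  have hI := unitIntegral_nodal_sq_le hQ
  set I := unitIntegral (Lagrange.nodal (gaussNodes Q) id ^ 2)
  have hfac : ((2 * Q).factorial : ℝ) ≠ 0 := by positivity
  calc _ = A / normConst β / 2 ^ (2 * Q) * (I * (2 * Q + 1)) := by field_simp
    _ ≤ A / normConst β / 2 ^ (2 * Q) * (2 ^ (2 * Q) * (8 * Q / 16 ^ Q)) := by gcongr
    _ = _ := by field_simp

theorem norm_error_le {d : ℕ} {L H : Matrix (Fin d) (Fin d) ℂ} (hL : L.IsHermitian)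
    (hH : H.IsHermitian) {β : ℝ} (hβ0 : 0 < β) (hβ1 : β < 1) {t : ℝ} (ht : 0 < t) {K h : ℝ}
    (hh : 0 < h) (hh1 : h ≤ 1) (hLh : t * ‖L‖ * h ≤ 1 / Real.exp 1) {N : ℕ} (hK : K = N * h)
    {Q : ℕ} (hQ : 0 < Q) :
    ‖(∫ k in (-K)..K, kernel β k • propagator L H t k) - lchsQuadrature L H β t h N Q‖ ≤
      K * (Real.exp (1 / Real.exp 1) / normConst β * (8 * Q / 16 ^ Q)) := by
  obtain ⟨φ, hφ, hφE⟩ := exists_dual_vector'' ℂ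
    ((∫ k in (-K)..K, kernel β k • propagator L H t k) - lchsQuadrature L H β t h N Q)
  have h1 := re_apply_error φ L H β t hK Q
  rw [hφE] at h1
  have h2 := Complex.ofReal_re
    ‖(∫ k in (-K)..K, kernel β k • propagator L H t k) - lchsQuadrature L H β t h N Q‖
  refine (h2.symm.trans h1).trans_le ?_
  calc _ ≤ ∑ m ∈ Finset.Ico (-(N : ℤ)) (N : ℤ),
        h / 2 * (Real.exp (1 / Real.exp 1) / normConst β * (8 * Q / 16 ^ Q)) := by
        gcongr with m
        exact (le_abs_self _).trans
          (abs_re_gauss_error_le hφ hL hH hβ0 hβ1 ht hh hh1 hLh hQ m)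
    -- There are `2N` subintervals of weight `h / 2`, and `N h = K`.
    _ = _ := by
      rw [Finset.sum_const, Int.card_Ico, show ((N : ℤ) - -N).toNat = 2 * N by omega, hK,
        nsmul_eq_mul]
      push_cast
      ring

theorem tendsto_apply_error {d : ℕ} (φ : Matrix (Fin d) (Fin d) ℂ →L[ℂ] ℂ)
    (L H : Matrix (Fin d) (Fin d) ℂ) (β t : ℝ) {K h : ℝ} {N : ℕ} (hK : K = N * h) :
    Filter.Tendsto (fun Q => φ ((∫ k in (-K)..K, kernel β k • propagator L H t k) -
      lchsQuadrature L H β t h N Q)) Filter.atTop (nhds 0) := by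
  have hre : ∀ ψ : Matrix (Fin d) (Fin d) ℂ →L[ℂ] ℂ,
      Filter.Tendsto (fun Q => (ψ ((∫ k in (-K)..K, kernel β k • propagator L H t k) -
        lchsQuadrature L H β t h N Q)).re) Filter.atTop (nhds 0) := fun ψ => by
    simp only [re_apply_error ψ L H β t hK]
    rw [show (0 : ℝ) = ∑ m ∈ Finset.Ico (-(N : ℤ)) (N : ℤ), h / 2 * 0 by simp]
    refine tendsto_finsetSum _ fun m _ => (tendsto_gauss ?_).const_mul _
    have hc : Continuous fun k : ℝ => testedIntegrand ψ L H β t k :=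
      (ψ.continuous.comp (continuous_kernel_smul_propagator L H β t)).congr fun k => by
        rw [Function.comp_apply, map_smul, smul_eq_mul]; rfl
    have hs : Continuous fun x => subNode h m x := by unfold subNode; fun_prop
    exact Complex.continuous_re.comp (hc.comp hs)
  have h1 := hre φ
  -- The real part of `-i z` is the imaginary part of `z`.
  have h2 := hre ((-Complex.I) • φ)
  have h3 := (Complex.continuous_ofReal.tendsto 0).comp h1
  have h4 := ((Complex.continuous_ofReal.tendsto 0).comp h2).mul_const Complex.I
  have h5 := h3.add h4
  simp only [Complex.ofReal_zero, zero_mul, add_zero] at h5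
  refine h5.congr fun Q => ?_
  apply Complex.ext <;> simp

theorem tendsto_error {d : ℕ} (L H : Matrix (Fin d) (Fin d) ℂ) (β t : ℝ) {K h : ℝ} {N : ℕ}
    (hK : K = N * h) :
    Filter.Tendsto (fun Q => (∫ k in (-K)..K, kernel β k • propagator L H t k) -
      lchsQuadrature L H β t h N Q) Filter.atTop (nhds 0) := by
  refine tendsto_pi_nhds.2 fun i => tendsto_pi_nhds.2 fun j => ?_
  exact tendsto_apply_error (LinearMap.toContinuousLinearMap
    (Matrix.entryLinearMap ℂ ℂ i j)) L H β t hK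

/-! ### The Lambert function and the number of nodes. -/

/-- `w e^w` is `-1/e` at `-1` and tends to 0 at `-∞`, so the value is attained and
`Function.invFunOn` does not return its default. -/
theorem lambertWNegOne_spec {x : ℝ} (h1 : -(1 / Real.exp 1) ≤ x) (h2 : x < 0) :
    lambertWNegOne x ≤ -1 ∧ lambertWNegOne x * Real.exp (lambertWNegOne x) = x := by
  have hc : Continuous fun w : ℝ => w * Real.exp w := by fun_prop
  have hex : ∃ a ∈ Set.Iic (-1 : ℝ), a * Real.exp a = x := by
    have ht : Filter.Tendsto (fun w : ℝ => w * Real.exp w) Filter.atBot (nhds 0) := by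
      have := (Real.tendsto_pow_mul_exp_neg_atTop_nhds_zero 1).comp Filter.tendsto_neg_atBot_atTop
      simpa using this.neg
    obtain ⟨b, hb, hb1⟩ := ((ht.eventually (lt_mem_nhds h2)).and
      (Filter.eventually_le_atBot (-1))).exists
    obtain ⟨a, ha, hax⟩ := intermediate_value_Icc' hb1 hc.continuousOn
      (show x ∈ Set.Icc ((-1) * Real.exp (-1)) (b * Real.exp b) from ⟨by
        rw [Real.exp_neg, ← one_div]; linarith, hb.le⟩)
    exact ⟨a, ha.2, hax⟩
  exact ⟨Function.invFunOn_mem hex, Function.invFunOn_eq (f := fun w : ℝ => w * Real.exp w) hex⟩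

theorem mul_exp_neg_le {w y : ℝ} (hw : 1 ≤ w) (hwy : w ≤ y) :
    y * Real.exp (-y) ≤ w * Real.exp (-w) := by
  have h := Real.add_one_le_exp (y - w)
  have h1 : y ≤ w * Real.exp (y - w) := by nlinarith
  calc y * Real.exp (-y) ≤ w * Real.exp (y - w) * Real.exp (-y) := by gcongr
    _ = _ := by rw [mul_assoc, ← Real.exp_add]; congr 2; ring

/-- Accounts for the constants `3` and `e^(1/3)` in `lambertArg`. -/
theorem exp_inv_exp_one_le :
    Real.exp (1 / Real.exp 1) ≤ Real.pi * Real.exp (1 / 3) / 3 := by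
  have h1 : 1 / Real.exp 1 ≤ 1 / 3 + 0.036 := by
    rw [div_le_iff₀ (Real.exp_pos 1)]
    linarith [Real.exp_one_gt_d9]
  have h2 : Real.exp 0.036 ≤ 3.14 / 3 := by
    have h := Real.add_one_le_exp (-0.036 : ℝ)
    rw [Real.exp_neg] at h
    have h3 := mul_le_mul_of_nonneg_right h (Real.exp_pos 0.036).le
    rw [inv_mul_cancel₀ (Real.exp_pos _).ne'] at h3
    linarith
  calc Real.exp (1 / Real.exp 1) ≤ Real.exp (1 / 3) * Real.exp 0.036 := by
        rw [← Real.exp_add]; exact Real.exp_le_exp.2 h1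
    _ ≤ Real.exp (1 / 3) * (Real.pi / 3) := by
        gcongr
        linarith [Real.pi_gt_d2]
    _ = _ := by ring

theorem numNodes_spec {β K ε : ℝ} (hK : 0 < K) (hε : 0 < ε)
    (hz : -(1 / Real.exp 1) ≤ lambertArg β K ε) :
    0 < numNodes β K ε ∧
      K * (Real.exp (1 / Real.exp 1) / normConst β *
        (8 * numNodes β K ε / 16 ^ numNodes β K ε)) ≤ ε := by
  have hC := normConst_pos β
  have hπ := Real.pi_pos
  have hl : 0 < Real.log 2 := Real.log_pos one_lt_two
  have hlog : Real.logb 2 (Real.exp 1) = 1 / Real.log 2 := by rw [Real.logb, Real.log_exp]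
  have hz' : lambertArg β K ε =
      -(3 * normConst β * Real.log 2 / (2 * Real.pi * Real.exp (1 / 3)) * (ε / K)) := by
    rw [lambertArg, hlog]; field_simp
  have hz0 : lambertArg β K ε < 0 := by
    rw [hz']
    have : 0 < 3 * normConst β * Real.log 2 / (2 * Real.pi * Real.exp (1 / 3)) * (ε / K) := by
      positivity
    linarith
  obtain ⟨hW1, hW2⟩ := lambertWNegOne_spec hz hz0
  have hQ : 0 < numNodes β K ε := by
    rw [numNodes, Nat.ceil_pos, hlog]
    have : 0 < 1 / Real.log 2 / 4 := by positivity
    nlinarith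
  have hceil : -(Real.logb 2 (Real.exp 1) / 4) * lambertWNegOne (lambertArg β K ε) ≤
    numNodes β K ε := Nat.le_ceil _
  refine ⟨hQ, ?_⟩
  set W := lambertWNegOne (lambertArg β K ε)
  set Q := numNodes β K ε
  have hy : -W ≤ 4 * Q * Real.log 2 := by
    rw [hlog] at hceil
    calc -W = -(1 / Real.log 2 / 4) * W * (4 * Real.log 2) := by field_simp
      _ ≤ Q * (4 * Real.log 2) := by gcongr
      _ = _ := by ring
  -- `y e^(-y)` decreases on `[1, ∞)`, and at `y = -W` it equals `-lambertArg β K ε`.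
  have h := mul_exp_neg_le (by linarith) hy
  have hexp : Real.exp (-(4 * Q * Real.log 2)) = 1 / 16 ^ Q := by
    rw [Real.exp_neg, show 4 * (Q : ℝ) * Real.log 2 = (Q : ℝ) * (4 * Real.log 2) by ring,
      Real.exp_nat_mul, show 4 * Real.log 2 = ((4 : ℕ) : ℝ) * Real.log 2 by norm_num,
      Real.exp_nat_mul, Real.exp_log two_pos]
    norm_num
  rw [hexp, neg_neg, neg_mul, hW2, hz', neg_neg] at h
  have h2 : 8 * (Q : ℝ) / 16 ^ Q ≤ 3 * normConst β / (Real.pi * Real.exp (1 / 3)) * (ε / K) := by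
    have : 4 * Q * Real.log 2 * (1 / 16 ^ Q) * (2 / Real.log 2) ≤
        3 * normConst β * Real.log 2 / (2 * Real.pi * Real.exp (1 / 3)) * (ε / K) *
          (2 / Real.log 2) := by gcongr
    calc 8 * (Q : ℝ) / 16 ^ Q = 4 * Q * Real.log 2 * (1 / 16 ^ Q) * (2 / Real.log 2) := by
          field_simp; ring
      _ ≤ _ := this
      _ = _ := by field_simp
  calc _ ≤ K * (Real.pi * Real.exp (1 / 3) / 3 / normConst β *
        (3 * normConst β / (Real.pi * Real.exp (1 / 3)) * (ε / K))) := by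
        gcongr
        exact exp_inv_exp_one_le
    _ = ε := by field_simp

theorem lemma2 {d : ℕ} (L H : Matrix (Fin d) (Fin d) ℂ) (hL : L.IsHermitian)
    (hH : H.IsHermitian) (β : ℝ) (hβ0 : 0 < β) (hβ1 : β < 1) (t : ℝ) (ht : 0 < t)
    (K h : ℝ) (hK : 0 < K) (hh : 0 < h) (N : ℕ) (hN : K / h = (N : ℝ)) :
    (∀ ε : ℝ, 0 < ε → ∃ Q : ℕ, 0 < Q ∧
      ‖(∫ k in (-K)..K, kernel β k • propagator L H t k) - lchsQuadrature L H β t h N Q‖ ≤ ε) ∧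
    (h = 1 / (Real.exp 1 * t * ‖L‖) → h ≤ 1 →
      ∀ ε : ℝ, 0 < ε → -(1 / Real.exp 1) ≤ lambertArg β K ε →
        0 < numNodes β K ε ∧
        ‖(∫ k in (-K)..K, kernel β k • propagator L H t k) -
          lchsQuadrature L H β t h N (numNodes β K ε)‖ ≤ ε) := by
  have hKN : K = N * h := by rw [← hN, div_mul_cancel₀ _ hh.ne']
  constructor
  · intro ε hε
    have h1 := (tendsto_error L H β t hKN).norm
    rw [norm_zero] at h1
    obtain ⟨Q, hQ, hQ0⟩ := ((h1.eventually (gt_mem_nhds hε)).and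
      (Filter.eventually_gt_atTop 0)).exists
    exact ⟨Q, hQ0, hQ.le⟩
  · intro hhL hh1 ε hε hz
    obtain ⟨hQ, hle⟩ := numNodes_spec hK hε hz
    -- If `L = 0`, division by zero would make `h = 0`.
    have hL0 : ‖L‖ ≠ 0 := by
      intro h0
      rw [h0, mul_zero, div_zero] at hhL
      exact hh.ne' hhL
    have hLh : t * ‖L‖ * h ≤ 1 / Real.exp 1 := by
      rw [hhL]
      apply le_of_eq
      field_simp
    exact ⟨hQ, (norm_error_le hL hH hβ0 hβ1 ht hh hh1 hLh hKN hQ).trans hle⟩
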